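/- **Setting.** Let $\mathcal X\subset\mathbb R^n$ and $\Xi\subset\mathbb R^m$ be closed, $\beta\in(0,1)$, and let $\mathcal Y:\mathcal X\times\Xi\rightrightarrows\mathcal X$ be a set-valued mapping with nonempty compact values. Let $\varphi,\varphi_\nu:\mathcal X\times\mathcal X\times\Xi\to\mathbb R$ ($\nu\in\mathbb N$) be functions and $\mathbb P,\mathbb P_\nu$ Borel probability measures on $\Xi$. For a closed subset $\mathcal Z$ of a Euclidean space, let $\mathrm{lsc}(\mathcal Z)$ be the set of lower semicontinuous (lsc) functions $f:\mathcal Z\to[-\infty,\infty]$ with $f\not\equiv\infty$. For $f\in\mathrm{lsc}(\mathcal X)$ put $$b(f)(x,\xi)=\inf_{y\in\mathcal Y(x,\xi)}\{\varphi(x,y,\xi)+\beta f(y)\},\qquad B(f)(x)=\mathbb E_{\mathbb P}[b(f)(x,\tilde\xi)],$$ and define $b_\nu,B_\nu$ in the same way from $\varphi_\nu,\mathbb P_\nu$. *Conventions.* Functions $f_\nu:\mathcal Z\to[-\infty,\infty]$ *epi-converge* to $f:\mathcal Z\to[-\infty,\infty]$, written $f_\nu\overset{e}{\to}f$, if for each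 $z\in\mathcal Z$: $\liminf f_\nu(z_\nu)\ge f(z)$ for all $z_\nu\to z$ in $\mathcal Z$, and $\limsup f_\nu(z_\nu)\le f(z)$ for some $z_\nu\to z$ in $\mathcal Z$. A sequence of lsc functions $f_\nu$ is *equi-lsc* if at each $\bar z\in\mathcal Z$ either $\limsup_\nu f_\nu(\bar z)=-\infty$, or for all $\rho,\varepsilon\in(0,\infty)$ there are $\bar\nu\in\mathbb N$ and $\delta>0$ with $\inf_{z\in\mathcal Z,\,\|z-\bar z\|\le\delta}f_\nu(z)\ge\min\{f_\nu(\bar z)-\varepsilon,\rho\}$ for all $\nu\ge\bar\nu$; a sequence of upper semicontinuous functions $f_\nu$ is *equi-usc* if $\{-f_\nu\}$ is equi-lsc. The *outer limit* $\mathrm{LimOut}\,C_\nu$ of sets $C_\nu$ is the set of all limits of convergent sequences $z_\kappa\in C_{\nu_\kappa}$ with $\nu_1<\nu_2<\cdots$. For $f,g\in\mathrm{lsc}(\mathcal X)$, the *Attouch–Wets distance* is $$d(f,g)=\int_0^\infty\max_{z\in\mathcal X\times\mathbb R,\ \|z-z_{\rm ctr}\|_2\le\rho}\big|\mathrm{dist}(z,\mathrm{epi}\,f)-\mathrm{dist}(z,\mathrm{epi}\,g)\big|\,e^{-\rho}\,d\rho,$$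 where $z_{\rm ctr}\in\mathcal X\times\mathbb R$ is a fixed point and $\mathrm{epi}\,f=\{(x,\alpha)\in\mathcal X\times\mathbb R:f(x)\le\alpha\}$; it is a metric on $\mathrm{lsc}(\mathcal X)$. **Hypotheses.** Suppose that $\mathbb P_\nu\to\mathbb P$ weakly and that $\varphi_\nu\to\varphi$ both pointwise and in the sense of epi-convergence. Let $\mathcal V\subset\mathrm{lsc}(\mathcal X)$ be a set that is closed and compact under $d$ and such that: * for each $V\in\mathcal V$ and $x\in\mathcal X$, $b(V)(x,\cdot)$ is $\mathbb P$-integrable, and $B$ maps $\mathcal V$ into itself; for every $\nu\in\mathbb N$ the same holds for $b_\nu,\mathbb P_\nu,B_\nu$; * each sequence $\{V_\nu\}\subset\mathcal V$ that epi-converges to a function in $\mathrm{lsc}(\mathcal X)$ is equi-lsc; the functions $b_\nu(V_\nu)$ on $\mathcal X\times\Xi$ are lsc and form an equi-lsc sequence; and, for each $\bar x\in\mathcal X$, the functions $b_\nu(V_\nu)(\bar x,\cdot)$ on $\Xi$ are usc and form an equi-usc sequence, and $$\liminf_{\alpha\to-\infty}\ \liminf_{(\nu,x)\to(\infty,\bar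 x)}\mathbb E_{\mathbb P_\nu}\big[b_\nu(V_\nu)(x,\tilde\xi)\,\mathbb I\{b_\nu(V_\nu)(x,\tilde\xi)\le\alpha\}\big]=0,$$ $$\limsup_{\alpha\to\infty}\ \limsup_{\nu\to\infty}\mathbb E_{\mathbb P_\nu}\big[b_\nu(V_\nu)(\bar x,\tilde\xi)\,\mathbb I\{b_\nu(V_\nu)(\bar x,\tilde\xi)\ge\alpha\}\big]=0.$$ For each $\nu$ let $V_\nu\in\mathcal V$ be a fixed point of $B_\nu$, i.e. $V_\nu=B_\nu(V_\nu)$. **Conclusions.** (i) If $V_{\nu_\kappa}\overset{e}{\to}V\in\mathrm{lsc}(\mathcal X)$ is an epi-convergent subsequence of $\{V_\nu\}$, then $V\in\mathcal V$, $V=B(V)$, and for all $(x,\xi)\in\mathcal X\times\Xi$ $$\mathrm{LimOut}_{\kappa}\Big(\operatorname*{argmin}_{y\in\mathcal Y(x,\xi)}\{\varphi_{\nu_\kappa}(x,y,\xi)+\beta V_{\nu_\kappa}(y)\}\Big)\subset\operatorname*{argmin}_{y\in\mathcal Y(x,\xi)}\{\varphi(x,y,\xi)+\beta V(y)\}\ne\varnothing.$$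 (ii) If $V\in\mathcal V$ is the unique fixed point of $B$ in $\mathcal V$, then for all $(x,\xi)\in\mathcal X\times\Xi$ $$\mathrm{LimOut}_{\nu}\Big(\operatorname*{argmin}_{y\in\mathcal Y(x,\xi)}\{\varphi_{\nu}(x,y,\xi)+\beta V_{\nu}(y)\}\Big)\subset\operatorname*{argmin}_{y\in\mathcal Y(x,\xi)}\{\varphi(x,y,\xi)+\beta V(y)\}\ne\varnothing.$$ -/

import Mathlib

open Filter Topology MeasureTheory Set
open scoped ENNReal

noncomputable section

namespace EpiDP

/-! ### Lower semicontinuous functions, epi-convergence, equi-semicontinuity -/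

/-- Lower semicontinuous extended-real-valued functions on `Z` other than the constant `∞`. -/
structure LscFcns (Z : Type*) [TopologicalSpace Z] where
  toFun : Z → EReal
  lsc : LowerSemicontinuous toFun
  ne_top : toFun ≠ ⊤

instance {Z : Type*} [TopologicalSpace Z] : CoeFun (LscFcns Z) (fun _ => Z → EReal) :=
  ⟨LscFcns.toFun⟩

/-- Epi-convergence of `f ν` to `g`. -/
def EpiConverges {Z : Type*} [TopologicalSpace Z] (f : ℕ → Z → EReal) (g : Z → EReal) : Prop :=
  ∀ z : Z,
    (∀ u : ℕ → Z, Tendsto u atTop (𝓝 z) → g z ≤ liminf (fun ν => f ν (u ν)) atTop) ∧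
    (∃ u : ℕ → Z, Tendsto u atTop (𝓝 z) ∧ limsup (fun ν => f ν (u ν)) atTop ≤ g z)

/-- Pointwise convergence of extended-real-valued functions. -/
def PointwiseConverges {Z : Type*} (f : ℕ → Z → EReal) (g : Z → EReal) : Prop :=
  ∀ z : Z, Tendsto (fun ν => f ν z) atTop (𝓝 (g z))

/-- The sequence of lsc functions `f ν` is equi-lsc (asymptotically, at every point). On a product
the balls are those of the product metric, which gives the same notion as Euclidean balls. -/
def EquiLsc {Z : Type*} [PseudoMetricSpace Z] (f : ℕ → Z → EReal) : Prop :=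
  (∀ ν, LowerSemicontinuous (f ν)) ∧
  ∀ z₀ : Z, limsup (fun ν => f ν z₀) atTop = ⊥ ∨
    ∀ ρ ε : ℝ, 0 < ρ → 0 < ε → ∃ N : ℕ, ∃ δ : ℝ, 0 < δ ∧ ∀ ν ≥ N,
      min (f ν z₀ - (ε : EReal)) (ρ : EReal) ≤ ⨅ z ∈ Metric.closedBall z₀ δ, f ν z

/-- The sequence of usc functions `f ν` is equi-usc (asymptotically, at every point). -/
def EquiUsc {Z : Type*} [PseudoMetricSpace Z] (f : ℕ → Z → EReal) : Prop :=
  (∀ ν, UpperSemicontinuous (f ν)) ∧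
  ∀ z₀ : Z, liminf (fun ν => f ν z₀) atTop = ⊤ ∨
    ∀ ρ ε : ℝ, 0 < ρ → 0 < ε → ∃ N : ℕ, ∃ δ : ℝ, 0 < δ ∧ ∀ ν ≥ N,
      (⨆ z ∈ Metric.closedBall z₀ δ, f ν z) ≤ max (f ν z₀ + (ε : EReal)) ((-ρ : ℝ) : EReal)

/-- Outer limit of a sequence of sets: all limits of convergent subsequences of elements. -/
def outerLimit {Z : Type*} [TopologicalSpace Z] (C : ℕ → Set Z) : Set Z :=
  {z | ∃ k : ℕ → ℕ, StrictMono k ∧ ∃ u : ℕ → Z, (∀ i, u i ∈ C (k i)) ∧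
    Tendsto u atTop (𝓝 z)}

/-- Minimizers of `f` over the set `C`. -/
def argminOn {Z : Type*} (C : Set Z) (f : Z → EReal) : Set Z :=
  {z | z ∈ C ∧ ∀ w ∈ C, f z ≤ f w}

/-! ### The Attouch-Wets distance -/

section AttouchWets

set_option linter.unusedSectionVars false

variable {Z : Type*} [MetricSpace Z]

/-- The epigraph, as a subset of `Z × ℝ` with the Euclidean product metric. -/
def epigraph (f : Z → EReal) : Set (WithLp 2 (Z × ℝ)) :=
  {p | f p.fst ≤ ((p.snd : ℝ) : EReal)}

/-- `max {|dist (z, epi f) - dist (z, epi g)| : z in the closed ball of radius ρ around c}`. -/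
def awGap (c : WithLp 2 (Z × ℝ)) (f g : Z → EReal) (ρ : ℝ) : ℝ :=
  sSup ((fun z => |Metric.infDist z (epigraph f) - Metric.infDist z (epigraph g)|) ''
    Metric.closedBall c ρ)

/-- The Attouch-Wets distance centred at `c`. -/
def awDist (c : WithLp 2 (Z × ℝ)) (f g : Z → EReal) : ℝ :=
  ∫ ρ in Ioi (0 : ℝ), awGap c f g ρ * Real.exp (-ρ)

theorem awGap_nonneg (c : WithLp 2 (Z × ℝ)) (f g : Z → EReal) (ρ : ℝ) : 0 ≤ awGap c f g ρ := by
  apply Real.sSup_nonneg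
  rintro _ ⟨z, -, rfl⟩
  exact abs_nonneg _

theorem awGap_bound (c : WithLp 2 (Z × ℝ)) (f g : Z → EReal) (ρ : ℝ) (z : WithLp 2 (Z × ℝ))
    (hz : z ∈ Metric.closedBall c ρ) :
    |Metric.infDist z (epigraph f) - Metric.infDist z (epigraph g)| ≤
      |Metric.infDist c (epigraph f) - Metric.infDist c (epigraph g)| + 2 * ρ := by
  have hz' : dist z c ≤ ρ := hz
  have h1 := Metric.infDist_le_infDist_add_dist (s := epigraph f) (x := z) (y := c)
  have h2 := Metric.infDist_le_infDist_add_dist (s := epigraph f) (x := c) (y := z)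
  have h3 := Metric.infDist_le_infDist_add_dist (s := epigraph g) (x := z) (y := c)
  have h4 := Metric.infDist_le_infDist_add_dist (s := epigraph g) (x := c) (y := z)
  rw [dist_comm c z] at h2 h4
  have h5 := le_abs_self (Metric.infDist c (epigraph f) - Metric.infDist c (epigraph g))
  have h6 := neg_abs_le (Metric.infDist c (epigraph f) - Metric.infDist c (epigraph g))
  rw [abs_le]
  constructor <;> linarith

theorem awGap_bddAbove (c : WithLp 2 (Z × ℝ)) (f g : Z → EReal) (ρ : ℝ) :
    BddAbove ((fun z => |Metric.infDist z (epigraph f) - Metric.infDist z (epigraph g)|) ''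
      Metric.closedBall c ρ) := by
  refine ⟨|Metric.infDist c (epigraph f) - Metric.infDist c (epigraph g)| + 2 * ρ, ?_⟩
  rintro _ ⟨z, hz, rfl⟩
  exact awGap_bound c f g ρ z hz

theorem le_awGap (c : WithLp 2 (Z × ℝ)) (f g : Z → EReal) (ρ : ℝ) (z : WithLp 2 (Z × ℝ))
    (hz : z ∈ Metric.closedBall c ρ) :
    |Metric.infDist z (epigraph f) - Metric.infDist z (epigraph g)| ≤ awGap c f g ρ :=
  le_csSup (awGap_bddAbove c f g ρ) ⟨z, hz, rfl⟩

theorem awGap_mono (c : WithLp 2 (Z × ℝ)) (f g : Z → EReal) : Monotone (awGap c f g) := by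
  intro a b hab
  apply Real.sSup_le _ (awGap_nonneg c f g b)
  rintro _ ⟨z, hz, rfl⟩
  exact le_awGap c f g b z (Metric.closedBall_subset_closedBall hab hz)

theorem awGap_integrable (c : WithLp 2 (Z × ℝ)) (f g : Z → EReal) :
    IntegrableOn (fun ρ => awGap c f g ρ * Real.exp (-ρ)) (Ioi (0 : ℝ)) := by
  set C := |Metric.infDist c (epigraph f) - Metric.infDist c (epigraph g)| with hC
  have hexp : IntegrableOn (fun ρ : ℝ => Real.exp (-ρ)) (Ioi (0 : ℝ)) := integrableOn_exp_neg_Ioi 0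
  have hid : IntegrableOn (fun ρ : ℝ => ρ * Real.exp (-ρ)) (Ioi (0 : ℝ)) := by
    have h := Real.GammaIntegral_convergent (s := 2) (by norm_num)
    refine h.congr_fun (fun x _ => ?_) measurableSet_Ioi
    norm_num [mul_comm]
  have hdom : IntegrableOn (fun ρ : ℝ => C * Real.exp (-ρ) + 2 * (ρ * Real.exp (-ρ)))
      (Ioi (0 : ℝ)) := (hexp.const_mul C).add (hid.const_mul 2)
  refine Integrable.mono' hdom ?_ ?_
  · exact ((awGap_mono c f g).measurable.mul
      (Real.measurable_exp.comp measurable_neg)).aestronglyMeasurable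
  · refine (ae_restrict_iff' measurableSet_Ioi).2 (Eventually.of_forall fun ρ hρ => ?_)
    have hρ' : (0 : ℝ) < ρ := hρ
    have hb : awGap c f g ρ ≤ C + 2 * ρ := by
      refine Real.sSup_le ?_ (by positivity)
      rintro _ ⟨z, hz, rfl⟩
      exact awGap_bound c f g ρ z hz
    rw [Real.norm_of_nonneg (mul_nonneg (awGap_nonneg c f g ρ) (Real.exp_pos _).le)]
    calc awGap c f g ρ * Real.exp (-ρ) ≤ (C + 2 * ρ) * Real.exp (-ρ) :=
          mul_le_mul_of_nonneg_right hb (Real.exp_pos _).le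
      _ = _ := by ring

theorem awGap_triangle (c : WithLp 2 (Z × ℝ)) (f g h : Z → EReal) (ρ : ℝ) :
    awGap c f h ρ ≤ awGap c f g ρ + awGap c g h ρ := by
  apply Real.sSup_le _ (add_nonneg (awGap_nonneg _ _ _ _) (awGap_nonneg _ _ _ _))
  rintro _ ⟨z, hz, rfl⟩
  exact (abs_sub_le _ (Metric.infDist z (epigraph g)) _).trans
    (add_le_add (le_awGap c f g ρ z hz) (le_awGap c g h ρ z hz))

theorem epigraph_isClosed (f : LscFcns Z) : IsClosed (epigraph f) := by
  have h := f.lsc.isClosed_epigraph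
  have hc : Continuous (fun p : WithLp 2 (Z × ℝ) => (p.fst, ((p.snd : ℝ) : EReal))) := by
    have hp : Continuous (fun p : WithLp 2 (Z × ℝ) => WithLp.ofLp p) :=
      WithLp.prod_continuous_ofLp 2 Z ℝ
    exact (continuous_fst.comp hp).prodMk (continuous_coe_real_ereal.comp (continuous_snd.comp hp))
  exact h.preimage hc

theorem epigraph_nonempty (f : LscFcns Z) : (epigraph f).Nonempty := by
  obtain ⟨z, hz⟩ := Function.ne_iff.1 f.ne_top
  refine ⟨WithLp.toLp 2 (z, (f z).toReal), ?_⟩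
  exact EReal.le_coe_toReal hz

theorem epigraph_injective {f g : Z → EReal} (h : epigraph f = epigraph g) : f = g := by
  have key : ∀ z (r : ℝ), f z ≤ (r : EReal) ↔ g z ≤ (r : EReal) := fun z r =>
    Set.ext_iff.1 h (WithLp.toLp 2 (z, r))
  funext z
  apply le_antisymm
  · exact EReal.le_of_forall_lt_iff_le.1 fun r hr => (key z r).2 hr.le
  · exact EReal.le_of_forall_lt_iff_le.1 fun r hr => (key z r).1 hr.le

theorem eq_of_awDist_eq_zero (c : WithLp 2 (Z × ℝ)) (f g : LscFcns Z)
    (h : awDist c f g = 0) : f = g := by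
  have hae : (fun ρ => awGap c f g ρ * Real.exp (-ρ)) =ᵐ[volume.restrict (Ioi (0 : ℝ))] 0 :=
    (integral_eq_zero_iff_of_nonneg
      (fun ρ => mul_nonneg (awGap_nonneg c f g ρ) (Real.exp_pos _).le)
      (awGap_integrable c f g)).1 h
  have hzero : ∀ r : ℝ, 0 ≤ r → awGap c f g r = 0 := by
    intro r hr
    by_contra hne
    have hpos : 0 < awGap c f g r := lt_of_le_of_ne (awGap_nonneg c f g r) (Ne.symm hne)
    have h2 := (ae_restrict_iff' measurableSet_Ioi).1 hae
    have h3 : volume (Ioi r) = 0 := by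
      refine measure_mono_null (fun s hs => ?_) (ae_iff.1 h2)
      have hs' : r < s := hs
      have hp : 0 < awGap c f g s * Real.exp (-s) :=
        mul_pos (hpos.trans_le (awGap_mono c f g hs'.le)) (Real.exp_pos _)
      simp only [mem_ofPred_eq, Pi.zero_apply, Classical.not_imp]
      exact ⟨hr.trans_lt hs', hp.ne'⟩
    simp at h3
  have hd : ∀ z, Metric.infDist z (epigraph f) = Metric.infDist z (epigraph g) := by
    intro z
    have h1 := le_awGap c f g (dist z c) z (Metric.mem_closedBall.2 le_rfl)
    rw [hzero _ dist_nonneg] at h1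
    exact sub_eq_zero.1 (abs_nonpos_iff.1 h1)
  have he : epigraph f = epigraph g := by
    ext z
    rw [(epigraph_isClosed f).mem_iff_infDist_zero (epigraph_nonempty f),
      (epigraph_isClosed g).mem_iff_infDist_zero (epigraph_nonempty g), hd z]
  have hfg := epigraph_injective he
  cases f
  cases g
  simpa using hfg

/-- The Attouch-Wets distance makes the lsc functions a metric space. -/
@[reducible] def awMetric (c : WithLp 2 (Z × ℝ)) : MetricSpace (LscFcns Z) where
  dist f g := awDist c f g
  dist_self f := by
    have : ∀ ρ, awGap c f f ρ = 0 := fun ρ => le_antisymm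
      (Real.sSup_le (by rintro _ ⟨z, -, rfl⟩; simp) le_rfl) (awGap_nonneg c f f ρ)
    simp [awDist, this]
  dist_comm f g := by simp only [awDist, awGap, abs_sub_comm]
  dist_triangle f g h := by
    unfold awDist
    rw [← integral_add (awGap_integrable c f g) (awGap_integrable c g h)]
    refine integral_mono (awGap_integrable c f h)
      ((awGap_integrable c f g).add (awGap_integrable c g h)) fun ρ => ?_
    simp only [← add_mul]
    exact mul_le_mul_of_nonneg_right (awGap_triangle c f g h ρ) (Real.exp_pos _).le
  eq_of_dist_eq_zero {f g} h := eq_of_awDist_eq_zero c f g h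

/-- Closedness under the Attouch-Wets distance. -/
def IsAWClosed (c : WithLp 2 (Z × ℝ)) (𝒱 : Set (LscFcns Z)) : Prop :=
  @IsClosed _ (awMetric c).toPseudoMetricSpace.toUniformSpace.toTopologicalSpace 𝒱

/-- Compactness under the Attouch-Wets distance. -/
def IsAWCompact (c : WithLp 2 (Z × ℝ)) (𝒱 : Set (LscFcns Z)) : Prop :=
  @IsCompact _ (awMetric c).toPseudoMetricSpace.toUniformSpace.toTopologicalSpace 𝒱

end AttouchWets

/-! ### Expectations and Bellman operators -/

/-- Expectation of an extended-real-valued function: `E[f⁺] - E[f⁻]`. -/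
def expect {Ω : Type*} [MeasurableSpace Ω] (P : Measure Ω) (f : Ω → EReal) : EReal :=
  ((∫⁻ ω, (f ω).toENNReal ∂P : ℝ≥0∞) : EReal) - ((∫⁻ ω, (-f ω).toENNReal ∂P : ℝ≥0∞) : EReal)

/-- Integrability of an extended-real-valued function: measurable with `E|f| < ∞`. -/
def IsIntegrable {Ω : Type*} [MeasurableSpace Ω] (P : Measure Ω) (f : Ω → EReal) : Prop :=
  Measurable f ∧ ∫⁻ ω, (f ω).abs ∂P < ⊤

/-- The one-stage objective `y ↦ φ(x, y, ξ) + β f(y)`. -/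
def stageObjective {X Ξ : Type*} (β : ℝ) (φ : X × X × Ξ → ℝ) (f : X → EReal) (x : X) (ξ : Ξ)
    (y : X) : EReal :=
  (φ (x, y, ξ) : EReal) + (β : EReal) * f y

/-- `b(f)(x, ξ) = inf {φ(x, y, ξ) + β f(y) : y ∈ Y(x, ξ)}`. -/
def bellmanIntegrand {X Ξ : Type*} (β : ℝ) (Y : X → Ξ → Set X) (φ : X × X × Ξ → ℝ)
    (f : X → EReal) (p : X × Ξ) : EReal :=
  ⨅ y ∈ Y p.1 p.2, stageObjective β φ f p.1 p.2 y

/-- The Bellman operator `B(f)(x) = E[b(f)(x, ξ)]`. -/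
def bellman {X Ξ : Type*} [MeasurableSpace Ξ] (β : ℝ) (Y : X → Ξ → Set X)
    (φ : X × X × Ξ → ℝ) (P : Measure Ξ) (f : X → EReal) (x : X) : EReal :=
  expect P (fun ξ => bellmanIntegrand β Y φ f (x, ξ))

/-- For each `V ∈ 𝒱`, the functions `b(V)(x, ·)` are integrable, and `B` maps `𝒱` into itself. -/
def BellmanRegular {X Ξ : Type*} [TopologicalSpace X] [MeasurableSpace Ξ] (β : ℝ)
    (Y : X → Ξ → Set X) (φ : X × X × Ξ → ℝ) (P : Measure Ξ) (𝒱 : Set (LscFcns X)) : Prop :=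
  (∀ V ∈ 𝒱, ∀ x, IsIntegrable P (fun ξ => bellmanIntegrand β Y φ V (x, ξ))) ∧
  (∀ V ∈ 𝒱, ∃ W ∈ 𝒱, (W : X → EReal) = bellman β Y φ P V)

open Classical in
/-- Asymptotic inf-integrability of `h ν (x, ·)` under `P ν` at the point `x₀`. -/
def AsympInfIntegrableAt {X Ξ : Type*} [TopologicalSpace X] [MeasurableSpace Ξ]
    (P : ℕ → Measure Ξ) (h : ℕ → X × Ξ → EReal) (x₀ : X) : Prop :=
  liminf (fun α : ℝ =>
    liminf (fun q : ℕ × X =>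
      expect (P q.1) (fun ξ => if h q.1 (q.2, ξ) ≤ (α : EReal) then h q.1 (q.2, ξ) else 0))
      (atTop ×ˢ 𝓝 x₀)) atBot = 0

open Classical in
/-- Asymptotic sup-integrability of `h ν (x₀, ·)` under `P ν`. -/
def AsympSupIntegrableAt {X Ξ : Type*} [MeasurableSpace Ξ]
    (P : ℕ → Measure Ξ) (h : ℕ → X × Ξ → EReal) (x₀ : X) : Prop :=
  limsup (fun α : ℝ =>
    limsup (fun ν : ℕ =>
      expect (P ν) (fun ξ => if (α : EReal) ≤ h ν (x₀, ξ) then h ν (x₀, ξ) else 0))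
      atTop) atTop = 0

end EpiDP

end

open EpiDP

namespace EpiDP

/-! ### Epi-convergence through filters -/

/-! The heart of the matter is that `V = B(V)` survives passage to the limit: for each `x`, the
numbers `V_ν(x) = B_ν(V_ν)(x)` along the subsequence tend both to `V(x)` and to `B(V)(x)`. The first
limit holds because equi-lsc turns epi-convergence into pointwise convergence
(`EpiConverges.tendsto_of_equiLsc`). For the second, compactness of `Y(x, ξ)` makes the Bellman
integrands converge pointwise (`tendsto_bellmanIntegrand`); equi-lsc and equi-usc strengthen this to
continuous convergence in `ξ`; a Fatou lemma for weakly convergent measures, together with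
negligible tails, then moves the limit through the expectations (`tendsto_expect`,
`tendsto_bellman`). The hypotheses concern full sequences indexed like `φ_ν`, so the gaps of a
subsequence are filled with its limit (`EpiConverges.extend`). Membership of the limit in `𝒱` comes
from compactness, since Attouch-Wets convergence implies epi-convergence and epi-limits are unique.
Minimizers pass to the limit because the stage objectives are bounded below jointly in index and
point and converge pointwise at each competitor. If `B` has only one fixed point in `𝒱`, every
subsequence of `V_ν` has a further one epi-converging to it, which reduces (ii) to (i). -/

theorem eventually_extend {Z : Type*} {k : ℕ → ℕ} (hk : StrictMono k) {u e : ℕ → Z}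
    {p : ℕ → Z → Prop} (hu : ∀ᶠ i in atTop, p (k i) (u i)) (he : ∀ᶠ ν in atTop, p ν (e ν)) :
    ∀ᶠ ν in atTop, p ν (Function.extend k u e ν) := by
  obtain ⟨N, hN⟩ := eventually_atTop.1 hu
  filter_upwards [he, eventually_ge_atTop (k N)] with ν h1 h2
  by_cases h : ∃ i, k i = ν
  · obtain ⟨i, rfl⟩ := h
    rw [hk.injective.extend_apply]
    exact hN i (hk.le_iff_le.1 h2)
  · rwa [Function.extend_apply' _ _ _ h]

theorem tendsto_extend {Z : Type*} {l : Filter Z} {k : ℕ → ℕ} (hk : StrictMono k) {u e : ℕ → Z}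
    (hu : Tendsto u atTop l) (he : Tendsto e atTop l) :
    Tendsto (Function.extend k u e) atTop l := fun s hs =>
  eventually_extend (p := fun _ z => z ∈ s) hk (hu hs) (he hs)

/-- Sequential liminf bounds amount to a joint neighbourhood bound: a failure yields points tending
to `z` along strictly increasing indices, and padding them with `z` gives a full sequence that
violates the liminf condition. -/
theorem EpiConverges.eventually_lt {Z : Type*} [TopologicalSpace Z] [FirstCountableTopology Z]
    {f : ℕ → Z → EReal} {g : Z → EReal} (h : EpiConverges f g) {z : Z} {a : EReal}
    (ha : a < g z) : ∀ᶠ p : ℕ × Z in atTop ×ˢ 𝓝 z, a < f p.1 p.2 := by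
  by_contra hcon
  obtain ⟨s, hs, hsa⟩ := exists_seq_forall_of_frequently (not_eventually.1 hcon)
  obtain ⟨j, hj, hmono⟩ := strictMono_subseq_of_tendsto_atTop (tendsto_fst.comp hs)
  have hu : Tendsto (fun i => (s (j i)).2) atTop (𝓝 z) :=
    (tendsto_snd.comp hs).comp hj.tendsto_atTop
  have hw := tendsto_extend hmono hu (tendsto_const_nhds (x := z))
  have hev := eventually_lt_of_lt_liminf (ha.trans_le ((h z).1 _ hw))
  obtain ⟨i, hi⟩ := (hmono.tendsto_atTop.eventually hev).exists
  rw [hmono.injective.extend_apply] at hi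
  exact hsa (j i) hi

theorem epiConverges_of_eventually {Z : Type*} [PseudoMetricSpace Z] {f : ℕ → Z → EReal}
    {g : Z → EReal}
    (hl : ∀ z, ∀ a < g z, ∀ᶠ p : ℕ × Z in atTop ×ˢ 𝓝 z, a < f p.1 p.2)
    (hu : ∀ z, ∀ a > g z, ∀ δ > 0, ∀ᶠ ν in atTop, ∃ u ∈ Metric.ball z δ, f ν u < a) :
    EpiConverges f g := by
  classical
  intro z
  constructor
  · intro u hu
    refine le_of_forall_lt fun a ha => ?_
    obtain ⟨b, hab, hb⟩ := exists_between ha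
    refine hab.trans_le (le_liminf_of_le (h := ?_))
    filter_upwards [(tendsto_id.prodMk hu).eventually (hl z b hb)] with ν hν using hν.le
  · rcases eq_or_ne (g z) ⊤ with htop | htop
    · exact ⟨fun _ => z, tendsto_const_nhds, htop ▸ le_top⟩
    obtain ⟨a, -, ha, hat⟩ := exists_seq_strictAnti_tendsto' (lt_top_iff_ne_top.2 htop)
    let Q : ℕ → ℕ → Prop := fun ν m => ∃ u ∈ Metric.ball z (1 / ((m : ℝ) + 1)), f ν u < a m
    have hQ : ∀ m, ∀ᶠ ν in atTop, Q ν m := fun m => hu z _ (ha m).1 _ (by positivity)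
    -- Diagonal choice of a recovery sequence: `M ν` is the best precision `m ≤ ν` achieved at index
    -- `ν`. If none is achieved it defaults to `0`, where `Q` may fail, so `u` below is constrained
    -- only conditionally.
    let M : ℕ → ℕ := fun ν => Nat.findGreatest (Q ν) ν
    have hM : ∀ m, ∀ᶠ ν in atTop, m ≤ M ν ∧ Q ν (M ν) := fun m => by
      filter_upwards [hQ m, eventually_ge_atTop m] with ν h1 h2
      exact ⟨Nat.le_findGreatest h2 h1, Nat.findGreatest_spec h2 h1⟩
    have hMt : Tendsto M atTop atTop :=
      tendsto_atTop.2 fun m => (hM m).mono fun _ h => h.1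
    have hex : ∀ ν, ∃ u, Q ν (M ν) → u ∈ Metric.ball z (1 / ((M ν : ℝ) + 1)) ∧ f ν u < a (M ν) := by
      intro ν
      by_cases h : Q ν (M ν)
      · obtain ⟨u, hu⟩ := h
        exact ⟨u, fun _ => hu⟩
      · exact ⟨z, fun h' => absurd h' h⟩
    choose u hu using hex
    have hev : ∀ᶠ ν in atTop, Q ν (M ν) := (hM 0).mono fun _ h => h.2
    refine ⟨u, ?_, ?_⟩
    · rw [tendsto_iff_dist_tendsto_zero]
      refine squeeze_zero' (Eventually.of_forall fun _ => dist_nonneg) ?_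
        ((tendsto_one_div_add_atTop_nhds_zero_nat (𝕜 := ℝ)).comp hMt)
      filter_upwards [hev] with ν hν using (Metric.mem_ball.1 (hu ν hν).1).le
    · calc limsup (fun ν => f ν (u ν)) atTop ≤ limsup (fun ν => a (M ν)) atTop :=
            limsup_le_limsup (by filter_upwards [hev] with ν hν using (hu ν hν).2.le)
        _ = g z := (hat.comp hMt).limsup_eq

/-- A recovery sequence for one limit is a test sequence for the liminf condition of the other. -/
theorem EpiConverges.unique {Z : Type*} [TopologicalSpace Z] {f : ℕ → Z → EReal}
    {g h : Z → EReal} (hg : EpiConverges f g) (hh : EpiConverges f h) : g = h := by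
  have key : ∀ {g h : Z → EReal}, EpiConverges f g → EpiConverges f h → g ≤ h := by
    intro g h hg hh z
    obtain ⟨u, hu, hle⟩ := (hh z).2
    exact ((hg z).1 u hu).trans (le_trans liminf_le_limsup hle)
  exact le_antisymm (key hg hh) (key hh hg)

theorem EpiConverges.subseq {Z : Type*} [TopologicalSpace Z] [FirstCountableTopology Z]
    {f : ℕ → Z → EReal} {g : Z → EReal} (h : EpiConverges f g) {k : ℕ → ℕ} (hk : StrictMono k) :
    EpiConverges (fun i => f (k i)) g := by
  intro z
  constructor
  · intro u hu
    refine le_of_forall_lt fun a ha => ?_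
    obtain ⟨b, hab, hb⟩ := exists_between ha
    refine hab.trans_le (le_liminf_of_le (h := ?_))
    filter_upwards [(hk.tendsto_atTop.prodMk hu).eventually (h.eventually_lt hb)] with ν hν
      using hν.le
  · obtain ⟨u, hu, hle⟩ := (h z).2
    refine ⟨fun i => u (k i), hu.comp hk.tendsto_atTop, le_trans ?_ hle⟩
    exact limsup_le_limsup_of_le (f := map k atTop) (u := fun ν => f ν (u ν)) hk.tendsto_atTop

/-- Filling the gaps of an epi-convergent subsequence with its lsc limit keeps epi-convergence. -/
theorem EpiConverges.extend {Z : Type*} [PseudoMetricSpace Z] {F : ℕ → LscFcns Z}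
    {G : LscFcns Z} (h : EpiConverges (fun i => (F i : Z → EReal)) G) {k : ℕ → ℕ} (hk : StrictMono k) :
    EpiConverges (fun ν => (Function.extend k F (fun _ => G) ν).toFun) G := by
  intro z
  constructor
  · intro u hu
    refine le_of_forall_lt fun a ha => ?_
    obtain ⟨b, hab, hb⟩ := exists_between ha
    refine hab.trans_le (le_liminf_of_le (h := ?_))
    -- On the range of `k` the bound comes from epi-convergence, in the gaps from lower
    -- semicontinuity of `G`.
    refine eventually_extend (p := fun ν (W : LscFcns Z) => b ≤ W (u ν)) hk ?_ ?_
    · have hku := hu.comp hk.tendsto_atTop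
      filter_upwards [(tendsto_id.prodMk hku).eventually (h.eventually_lt hb)] with i hi using hi.le
    · filter_upwards [hu.eventually (G.lsc z b hb)] with i hi using hi.le
  · obtain ⟨u, hu, hle⟩ := (h z).2
    refine ⟨Function.extend k u fun _ => z, tendsto_extend hk hu tendsto_const_nhds, ?_⟩
    refine le_of_forall_gt_imp_ge_of_dense fun b hb => limsup_le_of_le (h := ?_)
    have hev := eventually_lt_of_limsup_lt (hle.trans_lt hb)
    obtain ⟨N, hN⟩ := eventually_atTop.1 hev
    filter_upwards [eventually_ge_atTop (k N)] with ν hν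
    by_cases hi : ∃ i, k i = ν
    · obtain ⟨i, rfl⟩ := hi
      rw [hk.injective.extend_apply, hk.injective.extend_apply]
      exact (hN i (hk.le_iff_le.1 hν)).le
    · rw [Function.extend_apply' _ _ _ hi, Function.extend_apply' _ _ _ hi]
      exact hb.le

/-! ### Attouch-Wets convergence implies epi-convergence -/

section AttouchWets

variable {Z : Type*} [MetricSpace Z]

/-- The gap grows with the radius, so on `(r, r + 1]` the integrand is at least the left-hand side.
-/
theorem awGap_mul_exp_le_awDist (c : WithLp 2 (Z × ℝ)) (f g : Z → EReal) {r : ℝ} (hr : 0 ≤ r) :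
    awGap c f g r * Real.exp (-(r + 1)) ≤ awDist c f g := by
  have hsub : Ioc r (r + 1) ⊆ Ioi (0 : ℝ) := fun x hx => hr.trans_lt hx.1
  calc awGap c f g r * Real.exp (-(r + 1))
      = ∫ _ in Ioc r (r + 1), awGap c f g r * Real.exp (-(r + 1)) := by simp
    _ ≤ ∫ ρ in Ioc r (r + 1), awGap c f g ρ * Real.exp (-ρ) := by
        refine setIntegral_mono_on (integrableOn_const (by simp)) ((awGap_integrable c f g).mono_set hsub)
          measurableSet_Ioc fun ρ hρ => ?_
        exact mul_le_mul (awGap_mono c f g hρ.1.le) (Real.exp_le_exp.2 (neg_le_neg hρ.2))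
          (Real.exp_pos _).le (awGap_nonneg _ _ _ _)
    _ ≤ awDist c f g := setIntegral_mono_set (awGap_integrable c f g)
        (Eventually.of_forall fun ρ => mul_nonneg (awGap_nonneg _ _ _ _) (Real.exp_pos _).le)
        hsub.eventuallyLE

theorem tendsto_infDist_epigraph {c : WithLp 2 (Z × ℝ)} {f : ℕ → Z → EReal} {g : Z → EReal}
    (h : Tendsto (fun i => awDist c (f i) g) atTop (𝓝 0)) (p : WithLp 2 (Z × ℝ)) :
    Tendsto (fun i => Metric.infDist p (epigraph (f i))) atTop
      (𝓝 (Metric.infDist p (epigraph g))) := by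
  rw [tendsto_iff_dist_tendsto_zero]
  have h' := h.mul_const (Real.exp (dist p c + 1))
  rw [zero_mul] at h'
  refine squeeze_zero (fun _ => dist_nonneg) (fun i => ?_) h'
  have h1 := le_awGap c (f i) g (dist p c) p (Metric.mem_closedBall.2 le_rfl)
  have h2 := awGap_mul_exp_le_awDist c (f i) g (r := dist p c) dist_nonneg
  rw [Real.dist_eq]
  refine h1.trans ?_
  rwa [Real.exp_neg, ← div_eq_mul_inv, div_le_iff₀ (Real.exp_pos _)] at h2

/-- Distances to the epigraphs converge at every point. A point strictly below the graph of `G`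
therefore stays a fixed distance away from the epigraphs of `F i`, which gives the lower bound; a
point of the epigraph of `G` is approximated by points of those epigraphs, which gives recovery
points. -/
theorem epiConverges_of_tendsto_awDist {c : WithLp 2 (Z × ℝ)} {F : ℕ → LscFcns Z} {G : LscFcns Z}
    (h : Tendsto (fun i => awDist c (F i) G) atTop (𝓝 0)) :
    EpiConverges (fun i => F i) G := by
  have hd := tendsto_infDist_epigraph h
  refine epiConverges_of_eventually (fun z a ha => ?_) (fun z a ha δ hδ => ?_)
  · obtain ⟨r, har, hr⟩ := EReal.lt_iff_exists_real_btwn.1 ha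
    set p : WithLp 2 (Z × ℝ) := WithLp.toLp 2 (z, r)
    have hp : p ∉ epigraph G := not_le.2 hr
    have hpos : 0 < Metric.infDist p (epigraph G) :=
      ((epigraph_isClosed G).notMem_iff_infDist_pos (epigraph_nonempty G)).1 hp
    have h1 : ∀ᶠ i in atTop,
        Metric.infDist p (epigraph G) / 2 < Metric.infDist p (epigraph (F i)) :=
      (hd p).eventually (lt_mem_nhds (half_lt_self hpos))
    filter_upwards [h1.prod_mk (Metric.ball_mem_nhds z (half_pos hpos))] with q hq
    refine har.trans (lt_of_not_ge fun hle => ?_)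
    -- A purely horizontal move from `p`, shorter than half its distance to the limit epigraph,
    -- cannot reach the epigraph of `F q.1`.
    have hmem : (WithLp.toLp 2 (q.2, r) : WithLp 2 (Z × ℝ)) ∈ epigraph (F q.1) := hle
    have h2 := Metric.infDist_le_dist_of_mem (x := p) hmem
    have h3 : dist p (WithLp.toLp 2 (q.2, r)) = dist q.2 z := by
      rw [WithLp.prod_dist_eq_add (by norm_num)]
      simp only [p, ENNReal.toReal_ofNat, Real.rpow_two, ← Real.sqrt_eq_rpow]
      simp [dist_comm z, Real.sqrt_sq dist_nonneg]
    have h4 := Metric.mem_ball.1 hq.2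
    linarith [hq.1]
  · obtain ⟨r, hr, hra⟩ := EReal.lt_iff_exists_real_btwn.1 ha
    -- The slack `s - r` absorbs the vertical error of the approximating epigraph point.
    obtain ⟨s, hrs, hsa⟩ := EReal.lt_iff_exists_real_btwn.1 hra
    have hrs' : r < s := EReal.coe_lt_coe_iff.1 hrs
    set p : WithLp 2 (Z × ℝ) := WithLp.toLp 2 (z, r)
    have hp : p ∈ epigraph G := hr.le
    have hd' := hd p
    rw [Metric.infDist_zero_of_mem hp] at hd'
    filter_upwards [hd'.eventually (gt_mem_nhds (lt_min hδ (sub_pos.2 hrs')))] with i hi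
    obtain ⟨q, hq, hpq⟩ := (Metric.infDist_lt_iff (epigraph_nonempty (F i))).1 hi
    obtain ⟨h1, h2⟩ := lt_min_iff.1 hpq
    have h3 : dist p.fst q.fst ≤ dist p q := WithLp.dist_fst_le p q
    have h4 : dist p.snd q.snd ≤ dist p q := WithLp.dist_snd_le p q
    refine ⟨q.fst, ?_, ?_⟩
    · rw [Metric.mem_ball, dist_comm]
      exact h3.trans_lt h1
    · have h5 : |r - q.snd| < s - r := by
        rw [← Real.dist_eq]
        exact h4.trans_lt h2
      have h6 : q.snd < s := by linarith [(abs_lt.1 h5).1]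
      exact (le_trans hq (EReal.coe_le_coe_iff.2 h6.le)).trans_lt hsa

theorem IsAWCompact.exists_epiConverges {c : WithLp 2 (Z × ℝ)} {𝒱 : Set (LscFcns Z)}
    (h : IsAWCompact c 𝒱) {F : ℕ → LscFcns Z} (hF : ∀ ν, F ν ∈ 𝒱) :
    ∃ G ∈ 𝒱, ∃ j : ℕ → ℕ, StrictMono j ∧ EpiConverges (fun i => F (j i)) G := by
  let := awMetric c
  have h' : IsCompact 𝒱 := h
  obtain ⟨G, hG, j, hj, hlim⟩ := h'.tendsto_subseq hF
  exact ⟨G, hG, j, hj,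
    epiConverges_of_tendsto_awDist (c := c) (tendsto_iff_dist_tendsto_zero.1 hlim)⟩

end AttouchWets

/-! ### Equi-semicontinuity -/

theorem EquiLsc.eventually_lt {Z : Type*} [PseudoMetricSpace Z] {f : ℕ → Z → EReal} {z : Z}
    {b : EReal} (hf : EquiLsc f) (hlim : Tendsto (fun ν => f ν z) atTop (𝓝 b)) {a : EReal}
    (ha : a < b) : ∀ᶠ p : ℕ × Z in atTop ×ˢ 𝓝 z, a < f p.1 p.2 := by
  obtain ⟨r, har, hr⟩ := EReal.lt_iff_exists_real_btwn.1 ha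
  obtain ⟨s, hrs, hsb⟩ := EReal.lt_iff_exists_real_btwn.1 hr
  have hrs' : r < s := EReal.coe_lt_coe_iff.1 hrs
  rcases hf.2 z with hbot | hequi
  · rw [hlim.limsup_eq] at hbot
    exact absurd (hbot ▸ ha) not_lt_bot
  -- The cap `|r| + 1` exceeds `r`, and the loss `s - r` lowers the bound `s` at the centre to `r`
  -- on the ball.
  obtain ⟨N, δ, hδ, hN⟩ := hequi (|r| + 1) (s - r) (by positivity) (sub_pos.2 hrs')
  have h1 := (hlim.eventually (lt_mem_nhds hsb)).and (eventually_ge_atTop N)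
  filter_upwards [h1.prod_mk (Metric.closedBall_mem_nhds z hδ)] with p hp
  obtain ⟨⟨h2, h3⟩, h4⟩ := hp
  refine har.trans_le (le_trans (le_min ?_ ?_) ((hN p.1 h3).trans (iInf₂_le p.2 h4)))
  · calc (r : EReal) = (s : EReal) - ((s - r : ℝ) : EReal) := by
          rw [← EReal.coe_sub]; congr 1; ring
      _ ≤ _ := EReal.sub_le_sub h2.le le_rfl
  · exact EReal.coe_le_coe_iff.2 (by linarith [le_abs_self r])

theorem EquiUsc.eventually_lt {Z : Type*} [PseudoMetricSpace Z] {f : ℕ → Z → EReal} {z : Z}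
    {b : EReal} (hf : EquiUsc f) (hlim : Tendsto (fun ν => f ν z) atTop (𝓝 b)) {a : EReal}
    (ha : b < a) : ∀ᶠ p : ℕ × Z in atTop ×ˢ 𝓝 z, f p.1 p.2 < a := by
  obtain ⟨r, hr, hra⟩ := EReal.lt_iff_exists_real_btwn.1 ha
  obtain ⟨s, hbs, hsr⟩ := EReal.lt_iff_exists_real_btwn.1 hr
  have hsr' : s < r := EReal.coe_lt_coe_iff.1 hsr
  rcases hf.2 z with htop | hequi
  · rw [hlim.liminf_eq] at htop
    exact absurd (htop ▸ ha) not_top_lt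
  obtain ⟨N, δ, hδ, hN⟩ := hequi (|r| + 1) (r - s) (by positivity) (sub_pos.2 hsr')
  have h1 := (hlim.eventually (gt_mem_nhds hbs)).and (eventually_ge_atTop N)
  filter_upwards [h1.prod_mk (Metric.closedBall_mem_nhds z hδ)] with p hp
  obtain ⟨⟨h2, h3⟩, h4⟩ := hp
  refine lt_of_le_of_lt (le_trans ((le_iSup₂ (f := fun w _ => f p.1 w) p.2 h4).trans (hN p.1 h3))
    (max_le ?_ ?_)) hra
  · calc f p.1 z + ((r - s : ℝ) : EReal) ≤ (s : EReal) + ((r - s : ℝ) : EReal) :=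
          add_le_add h2.le le_rfl
      _ = (r : EReal) := by rw [← EReal.coe_add]; congr 1; ring
  · exact EReal.coe_le_coe_iff.2 (by linarith [neg_abs_le r])

/-- Only the upper bound needs equi-lsc: a recovery sequence eventually lies in the `δ`-ball and has
small values, so the infimum over the ball is small, and equi-lsc carries this back to the centre.
-/
theorem EpiConverges.tendsto_of_equiLsc {Z : Type*} [PseudoMetricSpace Z] {f : ℕ → Z → EReal}
    {g : Z → EReal} (h : EpiConverges f g) (hf : EquiLsc f) : PointwiseConverges f g := by
  intro z
  refine tendsto_order.2 ⟨fun a ha => ?_, fun a ha => ?_⟩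
  · exact (tendsto_id.prodMk tendsto_const_nhds).eventually (h.eventually_lt ha)
  rcases hf.2 z with hbot | hequi
  · exact eventually_lt_of_limsup_lt (hbot ▸ bot_le.trans_lt ha)
  obtain ⟨r, hr, hra⟩ := EReal.lt_iff_exists_real_btwn.1 ha
  obtain ⟨s, hbs, hsr⟩ := EReal.lt_iff_exists_real_btwn.1 hr
  have hsr' : s < r := EReal.coe_lt_coe_iff.1 hsr
  obtain ⟨u, hu, hle⟩ := (h z).2
  obtain ⟨N, δ, hδ, hN⟩ := hequi (|s| + 1) (r - s) (by positivity) (sub_pos.2 hsr')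
  filter_upwards [eventually_lt_of_limsup_lt (hle.trans_lt hbs), eventually_ge_atTop N,
    hu.eventually (Metric.closedBall_mem_nhds z hδ)] with ν h1 h2 h3
  have h4 := ((hN ν h2).trans (iInf₂_le (u ν) h3)).trans_lt h1
  rcases min_lt_iff.1 h4 with h5 | h5
  · refine lt_trans ?_ hra
    rw [EReal.sub_lt_iff (.inl (EReal.coe_ne_bot _)) (.inl (EReal.coe_ne_top _)),
      ← EReal.coe_add] at h5
    convert h5 using 2
    ring
  · linarith [EReal.coe_lt_coe_iff.1 h5, le_abs_self s]

/-! ### Integrals of varying functions against weakly convergent measures -/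

section VaryingMeasures

variable {Ω : Type*} [MeasurableSpace Ω]

theorem lintegral_eq_lintegral_meas_ofReal_lt (μ : Measure Ω) {f : Ω → ℝ≥0∞} (hf : Measurable f)
    (hfin : ∀ ω, f ω ≠ ⊤) :
    ∫⁻ ω, f ω ∂μ = ∫⁻ t in Ioi (0 : ℝ), μ {ω | ENNReal.ofReal t < f ω} := by
  have h := lintegral_eq_lintegral_meas_lt μ (f := fun ω => (f ω).toReal)
    (Eventually.of_forall fun _ => ENNReal.toReal_nonneg) hf.ennreal_toReal.aemeasurable
  simp only [ENNReal.ofReal_toReal (hfin _)] at h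
  rw [h]
  refine setLIntegral_congr_fun measurableSet_Ioi fun t ht => ?_
  simp only [ENNReal.ofReal_lt_iff_lt_toReal (le_of_lt ht) (hfin _)]

theorem lintegral_eq_iSup_lintegral_min (μ : Measure Ω) {f : Ω → ℝ≥0∞} (hf : Measurable f) :
    ∫⁻ ω, f ω ∂μ = ⨆ n : ℕ, ∫⁻ ω, min (f ω) n ∂μ := by
  rw [← lintegral_iSup (fun n => hf.min measurable_const)]
  · refine lintegral_congr fun ω => ?_
    have h := inf_iSup_eq (f ω) (fun n : ℕ => (n : ℝ≥0∞))
    rw [ENNReal.iSup_natCast, inf_top_eq] at h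
    exact h
  · intro a b hab ω
    exact min_le_min le_rfl (Nat.cast_le.2 hab)

variable [TopologicalSpace Ω] [OpensMeasurableSpace Ω] [HasOuterApproxClosed Ω]
  {P : ProbabilityMeasure Ω} {Ps : ℕ → ProbabilityMeasure Ω}

/-- The increasing open sets `G N`, on which `a < f ν` for all `ν ≥ N`, cover `{a < g}`. The
portmanteau inequality applies to each of them, and continuity from below finishes. -/
theorem measure_lt_le_liminf (hP : Tendsto Ps atTop (𝓝 P)) {f : ℕ → Ω → ℝ≥0∞} {g : Ω → ℝ≥0∞}
    {a : ℝ≥0∞}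
    (h : ∀ ω, a < g ω → ∀ᶠ p : ℕ × Ω in atTop ×ˢ 𝓝 ω, a < f p.1 p.2) :
    (P : Measure Ω) {ω | a < g ω} ≤ liminf (fun ν => (Ps ν : Measure Ω) {ω | a < f ν ω}) atTop := by
  let G : ℕ → Set Ω := fun N => interior {ω | ∀ ν ≥ N, a < f ν ω}
  have hmono : Monotone G := fun N M hNM =>
    interior_mono fun ω hω ν hν => hω ν (hNM.trans hν)
  have hsub : {ω | a < g ω} ⊆ ⋃ N, G N := by
    intro ω hω
    obtain ⟨p, hp, q, hq, hpq⟩ := eventually_prod_iff.1 (h ω hω)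
    obtain ⟨N, hN⟩ := eventually_atTop.1 hp
    refine mem_iUnion.2 ⟨N, mem_interior_iff_mem_nhds.2 ?_⟩
    filter_upwards [hq] with ω' hω' ν hν using hpq (hN ν hν) hω'
  refine (measure_mono hsub).trans ?_
  rw [hmono.measure_iUnion]
  refine iSup_le fun N => ?_
  refine (ProbabilityMeasure.le_liminf_measure_open_of_tendsto hP isOpen_interior).trans ?_
  refine liminf_le_liminf ?_
  filter_upwards [eventually_ge_atTop N] with ν hν
  exact measure_mono fun ω hω => interior_subset hω ν hν

/-- Fatou's lemma for weakly convergent probability measures. -/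
theorem lintegral_le_liminf_lintegral (hP : Tendsto Ps atTop (𝓝 P)) {f : ℕ → Ω → ℝ≥0∞}
    {g : Ω → ℝ≥0∞} (hf : ∀ ν, Measurable (f ν)) (hg : Measurable g)
    (h : ∀ ω, ∀ a < g ω, ∀ᶠ p : ℕ × Ω in atTop ×ˢ 𝓝 ω, a < f p.1 p.2) :
    ∫⁻ ω, g ω ∂(P : Measure Ω) ≤ liminf (fun ν => ∫⁻ ω, f ν ω ∂(Ps ν : Measure Ω)) atTop := by
  rw [lintegral_eq_iSup_lintegral_min _ hg]
  refine iSup_le fun n => ?_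
  have hfin : ∀ x : ℝ≥0∞, min x n ≠ ⊤ := fun x =>
    ((min_le_right x _).trans_lt (ENNReal.natCast_lt_top n)).ne
  have hlim : ∫⁻ ω, min (g ω) n ∂(P : Measure Ω) ≤
      liminf (fun ν => ∫⁻ ω, min (f ν ω) n ∂(Ps ν : Measure Ω)) atTop := by
    rw [lintegral_eq_lintegral_meas_ofReal_lt _ (hg.min measurable_const) fun _ => hfin _]
    simp_rw [fun ν => lintegral_eq_lintegral_meas_ofReal_lt (Ps ν : Measure Ω)
      ((hf ν).min measurable_const) fun _ => hfin _]
    -- After the layer-cake formula, the levels `t` carry a fixed measure, so the classical Fatou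
    -- lemma applies.
    refine le_trans (lintegral_mono fun t => ?_) (lintegral_liminf_le fun ν => ?_)
    · refine measure_lt_le_liminf hP fun ω hω => ?_
      filter_upwards [h ω _ (lt_min_iff.1 hω).1] with p hp using lt_min hp (lt_min_iff.1 hω).2
    · refine Antitone.measurable fun s t hst => measure_mono fun ω hω => ?_
      exact (ENNReal.ofReal_le_ofReal hst).trans_lt hω
  refine hlim.trans (liminf_le_liminf (Eventually.of_forall fun ν => ?_))
  exact lintegral_mono fun ω => min_le_left _ _

/-- Reverse Fatou: apply the Fatou lemma to `M - min f M`; the finite bound `M` makes the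
subtraction reversible. -/
theorem limsup_lintegral_min_le (hP : Tendsto Ps atTop (𝓝 P)) {f : ℕ → Ω → ℝ≥0∞}
    {g : Ω → ℝ≥0∞} (hf : ∀ ν, Measurable (f ν)) (hg : Measurable g)
    (h : ∀ ω, ∀ a > g ω, ∀ᶠ p : ℕ × Ω in atTop ×ˢ 𝓝 ω, f p.1 p.2 < a) {M : ℝ≥0∞} (hM : M ≠ ⊤) :
    limsup (fun ν => ∫⁻ ω, min (f ν ω) M ∂(Ps ν : Measure Ω)) atTop ≤
      ∫⁻ ω, min (g ω) M ∂(P : Measure Ω) := by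
  have hle : ∀ (Q : ProbabilityMeasure Ω) (k : Ω → ℝ≥0∞),
      ∫⁻ ω, min (k ω) M ∂(Q : Measure Ω) ≤ M := fun Q k => by
    calc ∫⁻ ω, min (k ω) M ∂(Q : Measure Ω) ≤ ∫⁻ _, M ∂(Q : Measure Ω) :=
          lintegral_mono fun ω => min_le_right _ _
      _ = M := by simp
  have hsub : ∀ (Q : ProbabilityMeasure Ω) {k : Ω → ℝ≥0∞}, Measurable k →
      ∫⁻ ω, (M - min (k ω) M) ∂(Q : Measure Ω) = M - ∫⁻ ω, min (k ω) M ∂(Q : Measure Ω) :=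
    fun Q k hk => by
      rw [lintegral_sub (hk.min measurable_const) ((hle Q k).trans_lt hM.lt_top).ne
        (Eventually.of_forall fun ω => min_le_right _ _)]
      simp
  have hfatou := lintegral_le_liminf_lintegral hP (f := fun ν ω => M - min (f ν ω) M)
    (g := fun ω => M - min (g ω) M) (fun ν => measurable_const.sub ((hf ν).min measurable_const))
    (measurable_const.sub (hg.min measurable_const)) (fun ω a ha => by
      rw [lt_tsub_iff_left] at ha
      have haM : a < M := (le_self_add.trans_eq (add_comm _ _)).trans_lt ha
      have hlt : min (g ω) M < M - a := lt_tsub_iff_right.2 ha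
      rcases min_lt_iff.1 hlt with h1 | h1
      · filter_upwards [h ω _ h1] with p hp
        exact lt_tsub_iff_left.2 (lt_tsub_iff_right.1 ((min_le_left _ _).trans_lt hp))
      · exact absurd h1 (not_lt.2 tsub_le_self))
  simp only [hsub _ hg, hsub _ (hf _)] at hfatou
  rw [ENNReal.liminf_const_sub _ _ hM] at hfatou
  exact (ENNReal.sub_le_sub_iff_left
    (limsup_le_of_le (h := Eventually.of_forall fun ν => hle _ _)) hM).1 hfatou

/-- Fatou gives the lower bound. For the upper one, split `f ≤ min f M + f · 1{M ≤ f}`: reverse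
Fatou handles the truncation and `htail` the remainder, each costing `ε / 2`. -/
theorem tendsto_lintegral_of_tendsto_prod (hP : Tendsto Ps atTop (𝓝 P)) {f : ℕ → Ω → ℝ≥0∞}
    {g : Ω → ℝ≥0∞} (hf : ∀ ν, Measurable (f ν)) (hg : Measurable g)
    (h : ∀ ω, Tendsto (fun p : ℕ × Ω => f p.1 p.2) (atTop ×ˢ 𝓝 ω) (𝓝 (g ω)))
    (htail : ∀ ε : ℝ≥0∞, 0 < ε → ε ≠ ⊤ → ∃ M : ℝ≥0∞, M ≠ ⊤ ∧
      ∀ᶠ ν in atTop, ∫⁻ ω in {ω | M ≤ f ν ω}, f ν ω ∂(Ps ν : Measure Ω) ≤ ε) :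
    Tendsto (fun ν => ∫⁻ ω, f ν ω ∂(Ps ν : Measure Ω)) atTop
      (𝓝 (∫⁻ ω, g ω ∂(P : Measure Ω))) := by
  refine tendsto_of_le_liminf_of_limsup_le
    (lintegral_le_liminf_lintegral hP hf hg fun ω a ha => (h ω).eventually (lt_mem_nhds ha)) ?_
  refine ENNReal.le_of_forall_pos_le_add fun ε hε hfin => ?_
  have hε2 : (0 : ℝ≥0∞) < (ε : ℝ≥0∞) / 2 := by simpa using hε.ne'
  have hε2' : (ε : ℝ≥0∞) / 2 ≠ ⊤ := ENNReal.div_ne_top (by simp) (by simp)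
  obtain ⟨M, hM, hev⟩ := htail _ hε2 hε2'
  have hmin : ∫⁻ ω, min (g ω) M ∂(P : Measure Ω) ≤ ∫⁻ ω, g ω ∂(P : Measure Ω) :=
    lintegral_mono fun ω => min_le_left _ _
  have hlt : limsup (fun ν => ∫⁻ ω, min (f ν ω) M ∂(Ps ν : Measure Ω)) atTop <
      ∫⁻ ω, g ω ∂(P : Measure Ω) + ε / 2 :=
    ((limsup_lintegral_min_le hP hf hg
      (fun ω a ha => (h ω).eventually (gt_mem_nhds ha)) hM).trans hmin).trans_lt
      (ENNReal.lt_add_right hfin.ne hε2.ne')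
  refine limsup_le_of_le (h := ?_)
  filter_upwards [hev, eventually_lt_of_limsup_lt hlt] with ν h1 h2
  have hset : MeasurableSet {ω | M ≤ f ν ω} := measurableSet_le measurable_const (hf ν)
  calc ∫⁻ ω, f ν ω ∂(Ps ν : Measure Ω)
      ≤ ∫⁻ ω, (min (f ν ω) M + {ω | M ≤ f ν ω}.indicator (f ν) ω) ∂(Ps ν : Measure Ω) := by
        refine lintegral_mono fun ω => ?_
        by_cases hω : M ≤ f ν ω
        · rw [indicator_of_mem (by exact hω)]
          exact le_add_self
        · rw [min_eq_left (not_le.1 hω).le]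
          exact le_self_add
    _ = ∫⁻ ω, min (f ν ω) M ∂(Ps ν : Measure Ω) +
          ∫⁻ ω in {ω | M ≤ f ν ω}, f ν ω ∂(Ps ν : Measure Ω) := by
        rw [lintegral_add_left ((hf ν).min measurable_const), lintegral_indicator hset]
    _ ≤ (∫⁻ ω, g ω ∂(P : Measure Ω) + ε / 2) + ε / 2 := add_le_add h2.le h1
    _ = ∫⁻ ω, g ω ∂(P : Measure Ω) + ε := by rw [add_assoc, ENNReal.add_halves]

end VaryingMeasures

/-! ### Convergence of expectations -/

theorem ofReal_le_toENNReal_iff {a : ℝ} (ha : 0 < a) {e : EReal} :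
    ENNReal.ofReal a ≤ e.toENNReal ↔ (a : EReal) ≤ e := by
  refine ⟨fun h => ?_, fun h => EReal.toENNReal_le_toENNReal h⟩
  have h' := EReal.coe_ennreal_le_coe_ennreal_iff.2 h
  rw [EReal.coe_toENNReal_eq_max, EReal.coe_ennreal_ofReal, max_eq_left ha.le] at h'
  exact (le_max_iff.1 h').resolve_left (not_le.2 (EReal.coe_pos.2 ha))

theorem toENNReal_le_abs (e : EReal) : e.toENNReal ≤ e.abs := by
  induction e with
  | bot => simp
  | top => simp
  | coe x => simpa [EReal.abs_def] using ENNReal.ofReal_le_ofReal (le_abs_self x)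

section Expectation

variable {Ω : Type*} [MeasurableSpace Ω]

open Classical in
-- Since `α > 0`, the truncated function is nonnegative and no negative part remains.
theorem expect_ite_ge (P : Measure Ω) {f : Ω → EReal} (hf : Measurable f) {α : ℝ} (hα : 0 < α) :
    expect P (fun ω => if (α : EReal) ≤ f ω then f ω else 0) =
      ((∫⁻ ω in {ω | ENNReal.ofReal α ≤ (f ω).toENNReal}, (f ω).toENNReal ∂P : ℝ≥0∞) : EReal) := by
  have h0 : (0 : EReal) < α := EReal.coe_pos.2 hα
  have hset : MeasurableSet {ω | (α : EReal) ≤ f ω} := measurableSet_le measurable_const hf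
  have h1 : ∀ ω, (if (α : EReal) ≤ f ω then f ω else 0).toENNReal =
      {ω | (α : EReal) ≤ f ω}.indicator (fun ω => (f ω).toENNReal) ω := fun ω => by
    by_cases h : (α : EReal) ≤ f ω <;> simp [h]
  have h2 : ∀ ω, (-(if (α : EReal) ≤ f ω then f ω else 0)).toENNReal = 0 := fun ω => by
    refine EReal.toENNReal_of_nonpos ?_
    by_cases h : (α : EReal) ≤ f ω
    · simpa [h] using h0.le.trans h
    · simp [h]
  simp only [expect, h1, h2, ofReal_le_toENNReal_iff hα]
  rw [lintegral_indicator hset]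
  simp

open Classical in
theorem expect_ite_le (P : Measure Ω) {f : Ω → EReal} (hf : Measurable f) {α : ℝ} (hα : α < 0) :
    expect P (fun ω => if f ω ≤ (α : EReal) then f ω else 0) =
      -((∫⁻ ω in {ω | ENNReal.ofReal (-α) ≤ (-f ω).toENNReal}, (-f ω).toENNReal ∂P : ℝ≥0∞) :
        EReal) := by
  have h0 : (α : EReal) < 0 := EReal.coe_neg'.2 hα
  have hset : MeasurableSet {ω | f ω ≤ (α : EReal)} := measurableSet_le hf measurable_const
  have h1 : ∀ ω, (-(if f ω ≤ (α : EReal) then f ω else 0)).toENNReal =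
      {ω | f ω ≤ (α : EReal)}.indicator (fun ω => (-f ω).toENNReal) ω := fun ω => by
    by_cases h : f ω ≤ (α : EReal) <;> simp [h]
  have h2 : ∀ ω, (if f ω ≤ (α : EReal) then f ω else 0).toENNReal = 0 := fun ω => by
    refine EReal.toENNReal_of_nonpos ?_
    by_cases h : f ω ≤ (α : EReal)
    · simpa [h] using h.trans h0.le
    · simp [h]
  simp only [expect, h1, h2, ofReal_le_toENNReal_iff (neg_pos.2 hα), EReal.coe_neg,
    EReal.neg_le_neg_iff]
  rw [lintegral_indicator hset]
  simp

theorem AsympSupIntegrableAt.exists_tail_le {X : Type*} {P : ℕ → Measure Ω}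
    {h : ℕ → X × Ω → EReal} {x : X} (hs : AsympSupIntegrableAt P h x)
    (hm : ∀ ν, Measurable fun ω => h ν (x, ω)) {ε : ℝ≥0∞} (hε : 0 < ε) :
    ∃ M : ℝ≥0∞, M ≠ ⊤ ∧ ∀ᶠ ν in atTop,
      ∫⁻ ω in {ω | M ≤ (h ν (x, ω)).toENNReal}, (h ν (x, ω)).toENNReal ∂(P ν) ≤ ε := by
  have hε' : (0 : EReal) < ε := EReal.coe_ennreal_pos.2 hε
  rw [AsympSupIntegrableAt] at hs
  obtain ⟨α, hα, hα0⟩ :=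
    ((eventually_lt_of_limsup_lt (hs.trans_lt hε')).and (eventually_gt_atTop 0)).exists
  refine ⟨ENNReal.ofReal α, ENNReal.ofReal_ne_top, ?_⟩
  filter_upwards [eventually_lt_of_limsup_lt hα] with ν hν
  rw [expect_ite_ge _ (hm ν) hα0] at hν
  exact (EReal.coe_ennreal_lt_coe_ennreal_iff.1 hν).le

theorem AsympInfIntegrableAt.exists_tail_le {X : Type*} [TopologicalSpace X] {P : ℕ → Measure Ω}
    {h : ℕ → X × Ω → EReal} {x : X} (hs : AsympInfIntegrableAt P h x)
    (hm : ∀ ν, Measurable fun ω => h ν (x, ω)) {ε : ℝ≥0∞} (hε : 0 < ε) :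
    ∃ M : ℝ≥0∞, M ≠ ⊤ ∧ ∀ᶠ ν in atTop,
      ∫⁻ ω in {ω | M ≤ (-h ν (x, ω)).toENNReal}, (-h ν (x, ω)).toENNReal ∂(P ν) ≤ ε := by
  have hε' : -(ε : EReal) < 0 := by
    rw [EReal.neg_lt_comm, neg_zero]
    exact EReal.coe_ennreal_pos.2 hε
  rw [AsympInfIntegrableAt] at hs
  obtain ⟨α, hα, hα0⟩ :=
    ((eventually_lt_of_lt_liminf (hε'.trans_eq hs.symm)).and (eventually_lt_atBot 0)).exists
  refine ⟨ENNReal.ofReal (-α), ENNReal.ofReal_ne_top, ?_⟩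
  -- The joint liminf in index and point is specialised to the constant point `x`.
  have hx : Tendsto (fun ν : ℕ => (ν, x)) atTop (atTop ×ˢ 𝓝 x) :=
    tendsto_id.prodMk tendsto_const_nhds
  filter_upwards [hx.eventually (eventually_lt_of_lt_liminf hα)] with ν hν
  rw [expect_ite_le _ (hm ν) hα0, EReal.neg_lt_neg_iff] at hν
  exact (EReal.coe_ennreal_lt_coe_ennreal_iff.1 hν).le

/-- Expectations converge along weakly convergent probability measures when the integrands
converge continuously and have asymptotically negligible tails. -/
theorem tendsto_expect {X : Type*} [TopologicalSpace X] [TopologicalSpace Ω]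
    [OpensMeasurableSpace Ω] [HasOuterApproxClosed Ω] {P : ProbabilityMeasure Ω}
    {Ps : ℕ → ProbabilityMeasure Ω} (hP : Tendsto Ps atTop (𝓝 P)) {h : ℕ → X × Ω → EReal}
    {g : Ω → EReal} {x : X} (hm : ∀ ν, Measurable fun ω => h ν (x, ω))
    (hg : IsIntegrable (P : Measure Ω) g)
    (hlim : ∀ ω, Tendsto (fun p : ℕ × Ω => h p.1 (x, p.2)) (atTop ×ˢ 𝓝 ω) (𝓝 (g ω)))
    (hinf : AsympInfIntegrableAt (fun ν => (Ps ν : Measure Ω)) h x)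
    (hsup : AsympSupIntegrableAt (fun ν => (Ps ν : Measure Ω)) h x) :
    Tendsto (fun ν => expect (Ps ν : Measure Ω) fun ω => h ν (x, ω)) atTop
      (𝓝 (expect (P : Measure Ω) g)) := by
  have hmeas := EReal.continuous_toENNReal.measurable
  have hneg : Measurable fun e : EReal => -e := continuous_neg.measurable
  have hpos := tendsto_lintegral_of_tendsto_prod hP (fun ν => hmeas.comp (hm ν))
    (hmeas.comp hg.1) (fun ω => (EReal.continuous_toENNReal.tendsto _).comp (hlim ω))
    (fun ε hε _ => hsup.exists_tail_le hm hε)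
  have hnegp := tendsto_lintegral_of_tendsto_prod hP (fun ν => hmeas.comp (hneg.comp (hm ν)))
    (hmeas.comp (hneg.comp hg.1))
    (fun ω => ((EReal.continuous_toENNReal.comp continuous_neg).tendsto _).comp (hlim ω))
    (fun ε hε _ => hinf.exists_tail_le hm hε)
  have hfin₁ : ∫⁻ ω, (g ω).toENNReal ∂(P : Measure Ω) ≠ ⊤ :=
    ((lintegral_mono fun ω => toENNReal_le_abs _).trans_lt hg.2).ne
  have hfin₂ : ∫⁻ ω, (-g ω).toENNReal ∂(P : Measure Ω) ≠ ⊤ :=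
    ((lintegral_mono fun ω => (toENNReal_le_abs _).trans_eq (EReal.abs_neg _)).trans_lt hg.2).ne
  -- Integrability keeps the positive part finite, so `∞ - ∞` is excluded and subtraction is
  -- continuous here.
  have hadd := (EReal.continuousAt_add
    (p := (((∫⁻ ω, (g ω).toENNReal ∂(P : Measure Ω) : ℝ≥0∞) : EReal),
      -((∫⁻ ω, (-g ω).toENNReal ∂(P : Measure Ω) : ℝ≥0∞) : EReal)))
    (.inl (by simpa using hfin₁)) (.inl (EReal.coe_ennreal_ne_bot _))).tendsto
  exact hadd.comp ((EReal.tendsto_coe_ennreal.2 hpos).prodMk_nhds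
    ((continuous_neg.tendsto _).comp (EReal.tendsto_coe_ennreal.2 hnegp)))

end Expectation
/-! ### Stage objectives and Bellman integrands -/

/-- For `β > 0` the map `e ↦ s + β e` is strictly increasing on `EReal` and fixes both infinities.
-/
theorem lt_coe_add_coe_mul_iff {β : ℝ} (hβ : 0 < β) {a s : ℝ} {e : EReal} :
    (a : EReal) < (s : EReal) + (β : EReal) * e ↔ (((a - s) / β : ℝ) : EReal) < e := by
  induction e with
  | bot => simp [EReal.coe_mul_bot_of_pos hβ]
  | top => simp [EReal.coe_mul_top_of_pos hβ]
  | coe x =>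
    rw [← EReal.coe_mul, ← EReal.coe_add, EReal.coe_lt_coe_iff, EReal.coe_lt_coe_iff,
      div_lt_iff₀ hβ, sub_lt_iff_lt_add', mul_comm]

section Bellman

variable {X Ξ : Type*} {β : ℝ} {φ : X × X × Ξ → ℝ}
  {φs : ℕ → X × X × Ξ → ℝ} {V : X → EReal} {W : ℕ → X → EReal}

theorem tendsto_stageObjective
    (hφp : PointwiseConverges (fun ν p => (φs ν p : EReal)) (fun p => (φ p : EReal)))
    (hW : PointwiseConverges W V) (x : X) (ξ : Ξ) (y : X) :
    Tendsto (fun ν => stageObjective β (φs ν) (W ν) x ξ y) atTop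
      (𝓝 (stageObjective β φ V x ξ y)) := by
  have hmul : Tendsto (fun ν => (β : EReal) * W ν y) atTop (𝓝 ((β : EReal) * V y)) :=
    EReal.Tendsto.const_mul (hW y) (.inl (EReal.coe_ne_bot _)) (.inl (EReal.coe_ne_top _))
  exact (EReal.continuousAt_add (p := ((φ (x, y, ξ) : EReal), (β : EReal) * V y))
    (.inl (EReal.coe_ne_top _)) (.inl (EReal.coe_ne_bot _))).tendsto.comp
    ((hφp (x, y, ξ)).prodMk_nhds hmul)

variable [PseudoMetricSpace X] [PseudoMetricSpace Ξ]

theorem eventually_lt_stageObjective (hβ : 0 < β)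
    (hφe : EpiConverges (fun ν p => (φs ν p : EReal)) (fun p => (φ p : EReal)))
    (hW : EpiConverges W V) {x : X} {ξ : Ξ} {y : X} {a : EReal}
    (ha : a < stageObjective β φ V x ξ y) :
    ∀ᶠ p : ℕ × X in atTop ×ˢ 𝓝 y, a < stageObjective β (φs p.1) (W p.1) x ξ p.2 := by
  obtain ⟨r, har, hr⟩ := EReal.lt_iff_exists_real_btwn.1 ha
  -- The threshold is split: `t` goes to the value function and `r - β t` to the stage cost, so the
  -- two epi-lower bounds apply separately.
  obtain ⟨t, htr, ht⟩ := EReal.lt_iff_exists_real_btwn.1 ((lt_coe_add_coe_mul_iff hβ).1 hr)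
  have hφlt : (((r - β * t : ℝ) : EReal)) < φ (x, y, ξ) := by
    rw [EReal.coe_lt_coe_iff, div_lt_iff₀ hβ] at htr
    exact EReal.coe_lt_coe_iff.2 (by linarith)
  have hmap : Tendsto (fun p : ℕ × X => (p.1, (x, p.2, ξ))) (atTop ×ˢ 𝓝 y)
      (atTop ×ˢ 𝓝 (x, y, ξ)) :=
    tendsto_fst.prodMk
      (tendsto_const_nhds.prodMk_nhds (tendsto_snd.prodMk_nhds tendsto_const_nhds))
  filter_upwards [hmap.eventually (hφe.eventually_lt hφlt), hW.eventually_lt ht] with p h1 h2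
  refine har.trans ((lt_coe_add_coe_mul_iff hβ).2 (lt_of_le_of_lt ?_ h2))
  refine EReal.coe_le_coe_iff.2 ?_
  have h3 : r - β * t < φs p.1 (x, p.2, ξ) := EReal.coe_lt_coe_iff.1 h1
  rw [div_le_iff₀ hβ]
  linarith

/-- For the lower bound, the joint local bounds become uniform over the compact set `Y x ξ`. For the
upper bound, one nearly optimal `y` is held fixed. -/
theorem tendsto_bellmanIntegrand (hβ : 0 < β)
    (hφe : EpiConverges (fun ν p => (φs ν p : EReal)) (fun p => (φ p : EReal)))
    (hφp : PointwiseConverges (fun ν p => (φs ν p : EReal)) (fun p => (φ p : EReal)))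
    (hW : EpiConverges W V) (hWp : PointwiseConverges W V) {Y : X → Ξ → Set X}
    (hY : ∀ x ξ, IsCompact (Y x ξ)) :
    PointwiseConverges (fun ν => bellmanIntegrand β Y (φs ν) (W ν)) (bellmanIntegrand β Y φ V) := by
  rintro ⟨x, ξ⟩
  refine tendsto_order.2 ⟨fun a ha => ?_, fun a ha => ?_⟩
  · obtain ⟨b, hab, hb⟩ := exists_between ha
    have hmem : {p : ℕ × X | b < stageObjective β (φs p.1) (W p.1) x ξ p.2} ∈
        (atTop : Filter ℕ) ×ˢ 𝓝ˢ (Y x ξ) := (hY x ξ).mem_prod_nhdsSet_of_forall fun y hy =>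
      eventually_lt_stageObjective hβ hφe hW (hb.trans_le (iInf₂_le y hy))
    obtain ⟨p, hp, q, hq, hpq⟩ := eventually_prod_iff.1 (eventually_mem_set.2 hmem)
    filter_upwards [hp] with ν hν
    exact hab.trans_le (le_iInf₂ fun y hy => (hpq hν (hq.self_of_nhdsSet y hy)).le)
  · simp only [bellmanIntegrand, iInf_lt_iff] at ha
    obtain ⟨y, hy, hlt⟩ := ha
    filter_upwards [(tendsto_stageObjective hφp hWp x ξ y).eventually (gt_mem_nhds hlt)]
      with ν hν using (iInf₂_le y hy).trans_lt hν

theorem argminOn_stageObjective_nonempty (hβ : 0 < β)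
    (hφe : EpiConverges (fun ν p => (φs ν p : EReal)) (fun p => (φ p : EReal)))
    (hφp : PointwiseConverges (fun ν p => (φs ν p : EReal)) (fun p => (φ p : EReal)))
    (hW : EpiConverges W V) (hWp : PointwiseConverges W V) {C : Set X} (hC : IsCompact C)
    (hne : C.Nonempty) (x : X) (ξ : Ξ) :
    (argminOn C (stageObjective β φ V x ξ)).Nonempty := by
  have hlsc : LowerSemicontinuous (stageObjective β φ V x ξ) := by
    intro y a ha
    obtain ⟨b, hab, hb⟩ := exists_between ha
    obtain ⟨p, hp, q, hq, hpq⟩ :=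
      eventually_prod_iff.1 (eventually_lt_stageObjective hβ hφe hW hb)
    filter_upwards [hq] with y' hy'
    -- Lower semicontinuity of the limit objective: hold `y'` fixed and let the index tend to
    -- infinity in the joint lower bound.
    refine hab.trans_le (ge_of_tendsto (tendsto_stageObjective hφp hWp x ξ y') ?_)
    filter_upwards [hp] with ν hν using (hpq hν hy').le
  obtain ⟨y, hy, hmin⟩ := (hlsc.lowerSemicontinuousOn C).exists_isMinOn hne hC
  exact ⟨y, hy, fun w hw => hmin hw⟩

/-- In `f_ν(u_i) ≤ f_ν(w)`, the left side is bounded below along `u_i → y` and the right side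
converges. -/
theorem outerLimit_argminOn_subset (hβ : 0 < β)
    (hφe : EpiConverges (fun ν p => (φs ν p : EReal)) (fun p => (φ p : EReal)))
    (hφp : PointwiseConverges (fun ν p => (φs ν p : EReal)) (fun p => (φ p : EReal)))
    (hW : EpiConverges W V) (hWp : PointwiseConverges W V) {C : Set X} (hC : IsClosed C)
    (x : X) (ξ : Ξ) :
    outerLimit (fun ν => argminOn C (stageObjective β (φs ν) (W ν) x ξ)) ⊆
      argminOn C (stageObjective β φ V x ξ) := by
  rintro y ⟨k, hk, u, hu, hlim⟩
  refine ⟨hC.mem_of_tendsto hlim (Eventually.of_forall fun i => (hu i).1), fun w hw => ?_⟩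
  refine le_of_forall_lt fun a ha => ?_
  obtain ⟨b, hab, hb⟩ := exists_between ha
  refine hab.trans_le (ge_of_tendsto
    ((tendsto_stageObjective hφp hWp x ξ w).comp hk.tendsto_atTop) ?_)
  filter_upwards [(hk.tendsto_atTop.prodMk hlim).eventually
    (eventually_lt_stageObjective hβ hφe hW hb)] with i hi
  exact hi.le.trans ((hu i).2 w hw)

/-- The Bellman operators converge pointwise along an epi-convergent sequence. -/
theorem tendsto_bellman [MeasurableSpace Ξ] [OpensMeasurableSpace Ξ] (hβ : 0 < β)
    (hφe : EpiConverges (fun ν p => (φs ν p : EReal)) (fun p => (φ p : EReal)))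
    (hφp : PointwiseConverges (fun ν p => (φs ν p : EReal)) (fun p => (φ p : EReal)))
    (hW : EpiConverges W V) (hWp : PointwiseConverges W V) {Y : X → Ξ → Set X}
    (hY : ∀ x ξ, IsCompact (Y x ξ)) {P : ProbabilityMeasure Ξ} {Ps : ℕ → ProbabilityMeasure Ξ}
    (hP : Tendsto Ps atTop (𝓝 P)) {x : X}
    (hint : IsIntegrable (P : Measure Ξ) fun ξ => bellmanIntegrand β Y φ V (x, ξ))
    (hmeas : ∀ ν, Measurable fun ξ => bellmanIntegrand β Y (φs ν) (W ν) (x, ξ))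
    (hlsc : EquiLsc fun ν => bellmanIntegrand β Y (φs ν) (W ν))
    (husc : EquiUsc fun ν ξ => bellmanIntegrand β Y (φs ν) (W ν) (x, ξ))
    (hinf : AsympInfIntegrableAt (fun ν => (Ps ν : Measure Ξ))
      (fun ν => bellmanIntegrand β Y (φs ν) (W ν)) x)
    (hsup : AsympSupIntegrableAt (fun ν => (Ps ν : Measure Ξ))
      (fun ν => bellmanIntegrand β Y (φs ν) (W ν)) x) :
    Tendsto (fun ν => bellman β Y (φs ν) (Ps ν : Measure Ξ) (W ν) x) atTop
      (𝓝 (bellman β Y φ (P : Measure Ξ) V x)) := by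
  have hpt := tendsto_bellmanIntegrand hβ hφe hφp hW hWp hY
  refine tendsto_expect hP hmeas hint (fun ξ => ?_) hinf hsup
  -- Continuous convergence in `ξ`: the lower half restricts equi-lsc on the product to the slice at
  -- `x`, the upper half is equi-usc.
  refine tendsto_order.2 ⟨fun a ha => ?_, fun a ha => husc.eventually_lt (hpt (x, ξ)) ha⟩
  have hmap : Tendsto (fun p : ℕ × Ξ => (p.1, (x, p.2))) (atTop ×ˢ 𝓝 ξ) (atTop ×ˢ 𝓝 (x, ξ)) :=
    tendsto_fst.prodMk (tendsto_const_nhds.prodMk_nhds tendsto_snd)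
  exact hmap.eventually (hlsc.eventually_lt (hpt (x, ξ)) ha)

end Bellman

end EpiDP

/-! ### Limits of fixed points and of minimizers -/

theorem mainTheorem3 {n m : ℕ}
    -- closed state space, closed outcome space
    (X : Set (EuclideanSpace ℝ (Fin n))) (hX : IsClosed X)
    (Ξ : Set (EuclideanSpace ℝ (Fin m))) (hΞ : IsClosed Ξ)
    (β : ℝ) (hβ0 : 0 < β) (hβ1 : β < 1)
    -- nonempty compact-valued constraint mapping
    (Y : X → Ξ → Set X) (hYne : ∀ x ξ, (Y x ξ).Nonempty) (hYc : ∀ x ξ, IsCompact (Y x ξ))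
    -- stage costs
    (φ : X × X × Ξ → ℝ) (φs : ℕ → X × X × Ξ → ℝ)
    (hφe : EpiConverges (fun ν p => (φs ν p : EReal)) (fun p => (φ p : EReal)))
    (hφp : PointwiseConverges (fun ν p => (φs ν p : EReal)) (fun p => (φ p : EReal)))
    -- weakly converging distributions
    (P : ProbabilityMeasure Ξ) (Ps : ℕ → ProbabilityMeasure Ξ)
    (hP : Tendsto Ps atTop (𝓝 P))
    -- integrability and invariance of the set of candidate value functions
    (𝒱 : Set (LscFcns X))
    (hreg : BellmanRegular β Y φ (P : Measure Ξ) 𝒱)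
    (hregs : ∀ ν, BellmanRegular β Y (φs ν) (Ps ν : Measure Ξ) 𝒱)
    -- closedness and compactness under the Attouch-Wets distance centred at `c`
    (c : WithLp 2 (X × ℝ)) (hclosed : IsAWClosed c 𝒱) (hcompact : IsAWCompact c 𝒱)
    -- conditions on the epi-convergent sequences in `𝒱`
    (hseq : ∀ (V : ℕ → LscFcns X) (V₀ : LscFcns X), (∀ ν, V ν ∈ 𝒱) →
      EpiConverges (fun ν => V ν) V₀ →
      EquiLsc (fun ν => (V ν : X → EReal)) ∧
      EquiLsc (fun ν => bellmanIntegrand β Y (φs ν) (V ν)) ∧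
      ∀ x₀ : X,
        AsympInfIntegrableAt (fun ν => (Ps ν : Measure Ξ))
          (fun ν => bellmanIntegrand β Y (φs ν) (V ν)) x₀ ∧
        AsympSupIntegrableAt (fun ν => (Ps ν : Measure Ξ))
          (fun ν => bellmanIntegrand β Y (φs ν) (V ν)) x₀ ∧
        EquiUsc (fun ν ξ => bellmanIntegrand β Y (φs ν) (V ν) (x₀, ξ)))
    -- fixed points of the approximating Bellman operators
    (Vs : ℕ → LscFcns X) (hVs : ∀ ν, Vs ν ∈ 𝒱)
    (hfix : ∀ ν, (Vs ν : X → EReal) = bellman β Y (φs ν) (Ps ν : Measure Ξ) (Vs ν)) :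
    (∀ (k : ℕ → ℕ) (V : LscFcns X), StrictMono k →
      EpiConverges (fun i => Vs (k i)) V →
      V ∈ 𝒱 ∧ (V : X → EReal) = bellman β Y φ (P : Measure Ξ) V ∧
      ∀ x ξ,
        outerLimit (fun i => argminOn (Y x ξ) (stageObjective β (φs (k i)) (Vs (k i)) x ξ)) ⊆
          argminOn (Y x ξ) (stageObjective β φ V x ξ) ∧
        (argminOn (Y x ξ) (stageObjective β φ V x ξ)).Nonempty) ∧
    (∀ V ∈ 𝒱, (V : X → EReal) = bellman β Y φ (P : Measure Ξ) V →
      (∀ W ∈ 𝒱, (W : X → EReal) = bellman β Y φ (P : Measure Ξ) W → W = V) →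
      ∀ x ξ,
        outerLimit (fun ν => argminOn (Y x ξ) (stageObjective β (φs ν) (Vs ν) x ξ)) ⊆
          argminOn (Y x ξ) (stageObjective β φ V x ξ) ∧
        (argminOn (Y x ξ) (stageObjective β φ V x ξ)).Nonempty) := by
  have hpart : ∀ (k : ℕ → ℕ) (V : LscFcns X), StrictMono k →
      EpiConverges (fun i => Vs (k i)) V →
      V ∈ 𝒱 ∧ (V : X → EReal) = bellman β Y φ (P : Measure Ξ) V ∧
      ∀ x ξ,
        outerLimit (fun i => argminOn (Y x ξ) (stageObjective β (φs (k i)) (Vs (k i)) x ξ)) ⊆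
          argminOn (Y x ξ) (stageObjective β φ V x ξ) ∧
        (argminOn (Y x ξ) (stageObjective β φ V x ξ)).Nonempty := by
    intro k V hk hV
    have hVmem : V ∈ 𝒱 := by
      obtain ⟨G, hG, j, hj, hjG⟩ := hcompact.exists_epiConverges fun i => hVs (k i)
      have hfun : V.toFun = G.toFun := (hV.subseq hj).unique hjG
      have hVG : V = G := by
        cases V
        cases G
        simpa using hfun
      exact hVG ▸ hG
    -- Gap filling keeps each `Vs (k i)` paired with `φs (k i)` and `Ps (k i)`, as `hseq` requires.
    set W : ℕ → LscFcns X := Function.extend k (fun i => Vs (k i)) fun _ => V with hWdef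
    have hWk : ∀ i, W (k i) = Vs (k i) := fun i => hk.injective.extend_apply _ _ i
    have hWmem : ∀ ν, W ν ∈ 𝒱 := fun ν => by
      by_cases h : ∃ i, k i = ν
      · obtain ⟨i, rfl⟩ := h
        exact hWk i ▸ hVs _
      · rw [hWdef, Function.extend_apply' _ _ _ h]
        exact hVmem
    have hWe : EpiConverges (fun ν => (W ν).toFun) V := hV.extend hk
    obtain ⟨hWlsc, hblsc, hb⟩ := hseq W V hWmem hWe
    have hWp := hWe.tendsto_of_equiLsc hWlsc
    have hφek := hφe.subseq hk
    have hφpk : PointwiseConverges (fun i p => (φs (k i) p : EReal)) (fun p => (φ p : EReal)) :=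
      fun z => (hφp z).comp hk.tendsto_atTop
    have hVp : PointwiseConverges (fun i => (Vs (k i)).toFun) V := fun z => by
      simpa only [Function.comp_def, hWk] using (hWp z).comp hk.tendsto_atTop
    refine ⟨hVmem, funext fun x => ?_, fun x ξ =>
      ⟨outerLimit_argminOn_subset hβ0 hφek hφpk hV hVp (hYc x ξ).isClosed x ξ,
        argminOn_stageObjective_nonempty hβ0 hφek hφpk hV hVp (hYc x ξ) (hYne x ξ) x ξ⟩⟩
    obtain ⟨hinf, hsup, husc⟩ := hb x
    have hB := (tendsto_bellman hβ0 hφe hφp hWe hWp hYc hP (hreg.1 V hVmem x)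
      (fun ν => ((hregs ν).1 (W ν) (hWmem ν) x).1) hblsc husc hinf hsup).comp hk.tendsto_atTop
    refine tendsto_nhds_unique (hVp x) (hB.congr fun i => ?_)
    simp only [Function.comp_def, hWk]
    exact (congrFun (hfix (k i)) x).symm
  refine ⟨hpart, fun V hV hVfix hVuniq x ξ => ?_⟩
  -- Every cluster point is a fixed point in `𝒱` by part (i), hence equals `V`.
  have hsub : ∀ k : ℕ → ℕ, StrictMono k →
      ∃ j : ℕ → ℕ, StrictMono j ∧ EpiConverges (fun i => Vs (k (j i))) V := by
    intro k hk
    obtain ⟨G, hG, j, hj, hjG⟩ := hcompact.exists_epiConverges fun i => hVs (k i)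
    obtain ⟨-, hGfix, -⟩ := hpart (k ∘ j) G (hk.comp hj) hjG
    exact ⟨j, hj, hVuniq G hG hGfix ▸ hjG⟩
  constructor
  · rintro y ⟨k, hk, u, hu, hlim⟩
    obtain ⟨j, hj, hjV⟩ := hsub k hk
    -- The limit `y` is unchanged when its minimizers are thinned to the indices `k ∘ j`, along
    -- which part (i) applies.
    exact ((hpart (k ∘ j) V (hk.comp hj) hjV).2.2 x ξ).1
      ⟨id, strictMono_id, u ∘ j, fun i => hu (j i), hlim.comp hj.tendsto_atTop⟩
  · obtain ⟨j, hj, hjV⟩ := hsub id strictMono_id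
    exact ((hpart j V hj hjV).2.2 x ξ).2
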